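/- Let $D$ be a (possibly infinite) digraph that is \emph{solid}: for every finite set $X$ of vertices, $D-X$ has only finitely many strong components. Let $T\subseteq D$ be a normal spanning arborescence. Then $T$ reflects the horizon of $D$; that is, the maps $\psi\colon\Omega(D)\to\Omega(\overline T)$ and $\zeta\colon\Omega(\overline T)\to\Omega(\overline H)$ described below are well defined, $\zeta\circ\psi\colon\Omega(D)\to\Omega(\overline H)$ is a bijection, and it extends to a homeomorphism from the horizon of $D$ to the horizon of $\overline H$. \emph{Arborescences.} An arborescence $T\subseteq D$ is a rooted oriented tree that contains a directed path from its root to each of its vertices; it is spanning if $V(T)=V(D)$. Write $v\le_T w$ if $T$ contains a directed path from $v$ to $w$, and $\lfloor v\rfloor_T=\{w: v\le_T w\}$. A $T$-path is a non-trivial directed path in $D$ that meets $T$ exactly in its two endvertices. The normal assistant $H$ of $T$ in $D$ is obtained from $T$ by adding an edge $vw$ for every two $\le_T$-incomparable vertices $v,w\in V(T)$ for which $D$ contains a $T$-path from $\lfloor v\rfloor_T$ to $\lfloor w\rfloor_T$. The arborescence $T$ is normal in $D$ if $H$ contains no directed cycle. The solidifications $\overline T$ and $\overline H$ are obtained from $T$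 and $H$, respectively, by adding all edges $wv$ with $vw\in E(T)$. \emph{Ends and limit edges.} A directed ray in a digraph $G$ is solid if for every finite $X\subseteq V(G)$ it has a tail in some strong component of $G-X$. Two solid rays are equivalent if for every finite $X$ they have tails in the same strong component of $G-X$. The equivalence classes are the ends of $G$; they form the set $\Omega(G)$, and $C(X,\omega)$ is the strong component of $G-X$ containing a tail of every ray in $\omega$ (the component in which $\omega$ lives). For distinct ends $\omega,\eta$, the pair $\omega\eta$ is a limit edge if $G$ has an edge from $C(X,\omega)$ to $C(X,\eta)$ for every finite $X$ with $C(X,\omega)\ne C(X,\eta)$. \emph{The maps.} $\psi$ sends each end $\omega$ of $D$ to the end of $\overline T$ represented by the unique ray of $T$ that starts at the root and represents $\omega$ in $D$ (this ray exists and is unique); $\zeta$ sends each end of $\overline T$ to the end of $\overline H$ that contains it as a set of rays. \emph{Horizon.} The horizon of $G$ is the set $\Omega(G)$ together with a copy $[0,1]_\lambda$ of the unit interval for every limit edge $\lambda=\omega\eta$ between ends, where $0\in[0,1]_\lambda$ is identified with the tail $\omega$ and $1$ with the head $\eta$. Its topology is generated by the following sets, for $\varepsilon>0$ and finite $X\subseteq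 V(G)$. (i) For an end $\omega$: all ends that live in $C(X,\omega)$, all points of limit edges both of whose endpoints live in $C(X,\omega)$, and, for every limit edge with an endpoint living in $C(X,\omega)$, its points at distance less than $\varepsilon$ from that endpoint along the edge, other than its other endpoint. (ii) For a limit edge $\lambda=\omega\eta$ with $C(X,\omega)\ne C(X,\eta)$, an inner point $z\in(0,1)$ of $\lambda$ and $\varepsilon\le\min(z,1-z)$: all points $t$ with $|t-z|<\varepsilon$ on the limit edges $\omega'\eta'$ with $C(X,\omega')=C(X,\omega)$ and $C(X,\eta')=C(X,\eta)$. -/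

import Mathlib

namespace Digraph

variable {V : Type*}

/-! ### Strong components of `G - X` -/

/-- `v` can reach `w` in `G - X`. -/
def ReachAvoiding (G : Digraph V) (X : Set V) (v w : V) : Prop :=
  v ∉ X ∧ Relation.ReflTransGen (fun a b => G.Adj a b ∧ b ∉ X) v w

/-- The strong components of `G - X`: the classes of mutual reachability in `G - X`. -/
def strongComponents (G : Digraph V) (X : Set V) : Set (Set V) :=
  {C | ∃ v, v ∉ X ∧ C = {w | G.ReachAvoiding X v w ∧ G.ReachAvoiding X w v}}

/-- `G` is solid: `G - X` has only finitely many strong components, for every finite `X`. -/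
def IsSolidDigraph (G : Digraph V) : Prop :=
  ∀ X : Finset V, (G.strongComponents (X : Set V)).Finite

theorem ReachAvoiding.trans {G : Digraph V} {X : Set V} {u v w : V}
    (h₁ : G.ReachAvoiding X u v) (h₂ : G.ReachAvoiding X v w) : G.ReachAvoiding X u w :=
  ⟨h₁.1, h₁.2.trans h₂.2⟩

theorem strongComponents_eq {G : Digraph V} {X : Set V} {C C' : Set V}
    (hC : C ∈ G.strongComponents X) (hC' : C' ∈ G.strongComponents X) {x : V}
    (hx : x ∈ C) (hx' : x ∈ C') : C = C' := by
  obtain ⟨v, _, rfl⟩ := hC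
  obtain ⟨v', _, rfl⟩ := hC'
  ext w
  constructor
  · rintro ⟨h₁, h₂⟩
    exact ⟨hx'.1.trans (hx.2.trans h₁), h₂.trans (hx.1.trans hx'.2)⟩
  · rintro ⟨h₁, h₂⟩
    exact ⟨hx.1.trans (hx'.2.trans h₁), h₂.trans (hx'.1.trans hx.2)⟩

/-! ### Rays and ends -/

/-- A directed ray of `G`, given by the sequence of its vertices. -/
def IsRay (G : Digraph V) (R : ℕ → V) : Prop :=
  Function.Injective R ∧ ∀ n, G.Adj (R n) (R (n + 1))

/-- The ray `R` has a tail in `C`. -/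
def HasTailIn (R : ℕ → V) (C : Set V) : Prop := ∃ n, ∀ m, n ≤ m → R m ∈ C

/-- `R` is a solid ray of `G`: for every finite `X` it has a tail in a strong component
of `G - X`. -/
def IsSolidRay (G : Digraph V) (R : ℕ → V) : Prop :=
  G.IsRay R ∧ ∀ X : Finset V, ∃ C ∈ G.strongComponents (X : Set V), HasTailIn R C

theorem tail_component_eq {G : Digraph V} {X : Set V} {R : ℕ → V} {C C' : Set V}
    (hC : C ∈ G.strongComponents X) (hC' : C' ∈ G.strongComponents X)
    (h : HasTailIn R C) (h' : HasTailIn R C') : C = C' := by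
  obtain ⟨n, hn⟩ := h
  obtain ⟨n', hn'⟩ := h'
  exact strongComponents_eq hC hC' (hn (max n n') (le_max_left _ _))
    (hn' (max n n') (le_max_right _ _))

/-- Two solid rays are equivalent if for every finite `X` they have a tail in the same strong
component of `G - X`. -/
def endSetoid (G : Digraph V) : Setoid {R : ℕ → V // G.IsSolidRay R} where
  r R R' := ∀ X : Finset V, ∃ C ∈ G.strongComponents (X : Set V),
    HasTailIn R.1 C ∧ HasTailIn R'.1 C
  iseqv :=
    { refl := fun R X => by
        obtain ⟨C, hC, h⟩ := R.2.2 X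
        exact ⟨C, hC, h, h⟩
      symm := fun h X => by
        obtain ⟨C, hC, h₁, h₂⟩ := h X
        exact ⟨C, hC, h₂, h₁⟩
      trans := fun h h' X => by
        obtain ⟨C, hC, h₁, h₂⟩ := h X
        obtain ⟨C', hC', h₁', h₂'⟩ := h' X
        obtain rfl := tail_component_eq hC hC' h₂ h₁'
        exact ⟨C, hC, h₁, h₂'⟩ }

/-- The ends of `G`. -/
def Ends (G : Digraph V) : Type _ := Quotient G.endSetoid

/-- The vertex sequence `R` is a solid ray of `G` that belongs to the end `ω`. -/
def Represents (G : Digraph V) (R : ℕ → V) (ω : G.Ends) : Prop :=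
  ∃ h : G.IsSolidRay R, (Quotient.mk G.endSetoid ⟨R, h⟩ : G.Ends) = ω

/-- `C(X, ω)`: the strong component of `G - X` in which the end `ω` lives, i.e. the one
that contains a tail of one (equivalently every) ray representing `ω`. -/
def endComponent (G : Digraph V) (X : Finset V) (ω : G.Ends) : Set V :=
  Quotient.lift (s := G.endSetoid)
    (fun R => {v | ∃ C ∈ G.strongComponents (X : Set V), HasTailIn R.1 C ∧ v ∈ C})
    (fun R R' h => by
      obtain ⟨C₀, hC₀, h₁, h₂⟩ := h X
      ext v
      constructor
      · rintro ⟨C, hC, hR, hv⟩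
        obtain rfl := tail_component_eq hC₀ hC h₁ hR
        exact ⟨_, hC, h₂, hv⟩
      · rintro ⟨C, hC, hR, hv⟩
        obtain rfl := tail_component_eq hC₀ hC h₂ hR
        exact ⟨_, hC, h₁, hv⟩) ω

theorem endComponent_spec {G : Digraph V} (X : Finset V) {R : ℕ → V} {ω : G.Ends}
    (h : G.Represents R ω) :
    G.endComponent X ω ∈ G.strongComponents (X : Set V) ∧ HasTailIn R (G.endComponent X ω) := by
  obtain ⟨hR, rfl⟩ := h
  obtain ⟨C, hC, hRC⟩ := hR.2 X
  have : G.endComponent X (Quotient.mk G.endSetoid ⟨R, hR⟩) = C := by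
    ext v
    constructor
    · rintro ⟨C', hC', h', hv⟩
      rwa [tail_component_eq hC hC' hRC h']
    · intro hv
      exact ⟨C, hC, hRC, hv⟩
  rw [this]
  exact ⟨hC, hRC⟩

/-! ### Limit edges and the horizon -/

/-- `X` separates the ends `ω` and `η`. -/
def SeparatesEnds (G : Digraph V) (X : Finset V) (ω η : G.Ends) : Prop :=
  G.endComponent X ω ≠ G.endComponent X η

/-- `ωη` is a limit edge between the distinct ends `ω` and `η`. -/
def IsLimitEdge (G : Digraph V) (ω η : G.Ends) : Prop :=
  ω ≠ η ∧ ∀ X : Finset V, G.SeparatesEnds X ω η →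
    ∃ u ∈ G.endComponent X ω, ∃ v ∈ G.endComponent X η, G.Adj u v

/-- The limit edges between ends of `G`. -/
structure LimitEdge (G : Digraph V) where
  tail : G.Ends
  head : G.Ends
  isLimitEdge : G.IsLimitEdge tail head

/-- The ground set of the horizon of `G`: the ends of `G`, together with a copy of the open unit
interval `(0, 1)` (the inner points) for every limit edge between ends. This is the set
obtained from the ends and a copy `[0, 1]` for each limit edge by identifying every `0` with
the tail and every `1` with the head of its limit edge. -/
inductive Horizon (G : Digraph V) where
  | ofEnd (ω : G.Ends) : Horizon G
  | inner (l : G.LimitEdge) (t : Set.Ioo (0 : ℝ) 1) : Horizon G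

/-- The basic neighbourhood `Ω_ε(X, ω)` of an end: all ends that live in `C(X, ω)`; all inner
points of limit edges with both endpoints living in `C(X, ω)`; and, for every limit edge with
an endpoint living in `C(X, ω)`, its inner points at distance less than `ε` from that
endpoint. -/
def endNhd (G : Digraph V) (ε : ℝ) (X : Finset V) (ω : G.Ends) : Set G.Horizon :=
  {p | match p with
    | .ofEnd η => G.endComponent X η = G.endComponent X ω
    | .inner l t =>
        (G.endComponent X l.tail = G.endComponent X ω ∧
          G.endComponent X l.head = G.endComponent X ω) ∨
        (G.endComponent X l.tail = G.endComponent X ω ∧ (t : ℝ) < ε) ∨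
        (G.endComponent X l.head = G.endComponent X ω ∧ 1 - ε < (t : ℝ))}

/-- The basic neighbourhood `Λ_{ε,z}(X, l)` of the inner point `z` of the limit edge `l`: the
union of the open `ε`-balls around the points corresponding to `z` on all the limit edges `l'`
that live in the bundle of edges from `C(X, l.tail)` to `C(X, l.head)`. -/
def edgeNhd (G : Digraph V) (ε : ℝ) (z : Set.Ioo (0 : ℝ) 1) (X : Finset V) (l : G.LimitEdge) :
    Set G.Horizon :=
  {p | match p with
    | .ofEnd _ => False
    | .inner l' t =>
        G.endComponent X l'.tail = G.endComponent X l.tail ∧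
        G.endComponent X l'.head = G.endComponent X l.head ∧
        |(t : ℝ) - z| < ε}

/-- The topology of the horizon. In `edgeNhd` only those `ε` are allowed for which the `ε`-ball
around `z` is contained in the limit edge. -/
instance (G : Digraph V) : TopologicalSpace G.Horizon :=
  TopologicalSpace.generateFrom
    ({U | ∃ (ε : ℝ) (X : Finset V) (ω : G.Ends), 0 < ε ∧ U = G.endNhd ε X ω} ∪
     {U | ∃ (ε : ℝ) (z : Set.Ioo (0 : ℝ) 1) (X : Finset V) (l : G.LimitEdge),
        0 < ε ∧ ε ≤ z ∧ ε ≤ 1 - (z : ℝ) ∧ G.SeparatesEnds X l.tail l.head ∧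
        U = G.edgeNhd ε z X l})

/-! ### Arborescences and normal assistants -/

/-- An arborescence `T ⊆ D`, not necessarily spanning: a rooted oriented tree in which every
vertex is reached from the root by a directed path. That it is such a tree is expressed in the
usual way: no edge enters the root, no vertex is entered by two edges, and every vertex can be
reached from the root. -/
structure Arborescence (D : Digraph V) where
  verts : Set V
  Adj : V → V → Prop
  root : V
  root_mem : root ∈ verts
  mem_of_adj : ∀ {v w}, Adj v w → v ∈ verts ∧ w ∈ verts
  adj_sub : ∀ {v w}, Adj v w → D.Adj v w
  not_adj_root : ∀ v, ¬ Adj v root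
  parent_unique : ∀ {u v w}, Adj u w → Adj v w → u = v
  reach_root : ∀ v ∈ verts, Relation.ReflTransGen Adj root v

namespace Arborescence

variable {D : Digraph V} (T : D.Arborescence)

/-- `T` contains every vertex of `D`. -/
def IsSpanning : Prop := T.verts = Set.univ

/-- The arborescence as a digraph. (Vertices outside `T.verts` are isolated in it.) -/
def toDigraph : Digraph V := ⟨T.Adj⟩

/-- The tree order: `v ≤_T w` if `T` contains a directed path from `v` to `w`. -/
def le (v w : V) : Prop := Relation.ReflTransGen T.Adj v w

/-- There is a `T`-path in `D` from `a` to `b`: a non-trivial directed path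
`a, x₁, …, xₖ, b` of `D` whose two endvertices are the only vertices that it shares with `T`. -/
def HasTPath (a b : V) : Prop :=
  a ∈ T.verts ∧ b ∈ T.verts ∧ ∃ l : List V, (∀ x ∈ l, x ∉ T.verts) ∧
    (a :: (l ++ [b])).IsChain D.Adj ∧ (a :: (l ++ [b])).Nodup

/-- The normal assistant of `T` in `D`: add to `T` an edge `vw` for all `≤_T`-incomparable
vertices `v, w` of `T` for which `D` contains a `T`-path from the up-closure of `v` to the
up-closure of `w`. -/
def normalAssistant : Digraph V where
  Adj v w := T.Adj v w ∨
    (v ∈ T.verts ∧ w ∈ T.verts ∧ ¬ T.le v w ∧ ¬ T.le w v ∧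
      ∃ a b, T.le v a ∧ T.le w b ∧ T.HasTPath a b)

/-- `T` is normal in `D`: its normal assistant contains no directed cycle. -/
def IsNormal : Prop := ∀ v, ¬ Relation.TransGen T.normalAssistant.Adj v v

/-- The solidification of a digraph `G ⊇ T` (used for `T` itself and for its normal
assistant): add the reverse of every edge of `T`. -/
def solidify (G : Digraph V) : Digraph V where
  Adj v w := G.Adj v w ∨ T.Adj w v

/-- The solidification of `T`. -/
abbrev solidification : Digraph V := T.solidify T.toDigraph

/-- The solidification of the normal assistant of `T`. -/
abbrev assistantSolidification : Digraph V := T.solidify T.normalAssistant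

/-- `ψ` sends every end `ω` of `D` to the end of the solidification of `T` that is represented
by the unique ray of `T` that starts at the root and represents `ω` in `D`
(existence and uniqueness of this ray included). -/
def IsPsi (ψ : D.Ends → T.solidification.Ends) : Prop :=
  ∀ ω : D.Ends,
    (∃! R : ℕ → V, T.toDigraph.IsRay R ∧ R 0 = T.root ∧ D.Represents R ω) ∧
    ∀ R : ℕ → V, T.toDigraph.IsRay R → R 0 = T.root → D.Represents R ω →
      T.solidification.Represents R (ψ ω)

/-- `ζ` sends every end of the solidification of `T` to the end of the solidification of the
normal assistant that contains it as a subset (of rays). -/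
def IsZeta (ζ : T.solidification.Ends → T.assistantSolidification.Ends) : Prop :=
  ∀ (ε : T.solidification.Ends) (R : ℕ → V),
    T.solidification.Represents R ε → T.assistantSolidification.Represents R (ζ ε)

/-- `T` reflects the horizon of `D`: the map `ζ ∘ ψ` is a well-defined bijection between the
ends of `D` and those of the solidification of the normal assistant of `T`, and it extends to
a homeomorphism between the horizons. -/
def ReflectsHorizon : Prop :=
  ∃ (ψ : D.Ends → T.solidification.Ends)
    (ζ : T.solidification.Ends → T.assistantSolidification.Ends),
    T.IsPsi ψ ∧ T.IsZeta ζ ∧ Function.Bijective (ζ ∘ ψ) ∧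
    ∃ Θ : D.Horizon ≃ₜ T.assistantSolidification.Horizon,
      ∀ ω : D.Ends, Θ (.ofEnd ω) = .ofEnd (ζ (ψ ω))

end Arborescence

end Digraph

namespace Digraph

variable {V : Type*}

/-! ### Strong components -/

/-! The digraph `D` and the solidified assistant are both displayed by `T` (`Displays`): components
left by finite deletions and up-closures at fixed heights refine each other. So in either digraph
the ends correspond to the root rays of `T`, living in the same component amounts to agreeing up to
some height, and limit edges are pairs of rays with an edge between their up-closures at every
height where they differ (`isLimitEdge_iff`). These edge conditions agree for the two digraphs, and
the horizon depends on nothing else (`Horizon.homeomorph`).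

Normality gives each strong component a least element (`Governs.exists_least`): otherwise a closed
walk in the component, projected to the children of a common lower bound, would yield a directed
cycle in the assistant. Solidity then makes the levels of `T` finite (`finite_height_lt`) and bounds
the heights of the least elements, so high up-closures in `D` stay in one component
(`displays_self`). In the solidified assistant the reversed tree edges give this at once. -/

theorem ReachAvoiding.mono {G : Digraph V} {X Y : Set V} (h : X ⊆ Y) {u v : V}
    (huv : G.ReachAvoiding Y u v) : G.ReachAvoiding X u v :=
  ⟨fun hu => huv.1 (h hu), Relation.ReflTransGen.mono (fun _ _ hab => ⟨hab.1, fun hb => hab.2 (h hb)⟩) _ _ huv.2⟩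

theorem exists_strongComponent (G : Digraph V) {X : Set V} {v : V} (hv : v ∉ X) :
    ∃ C ∈ G.strongComponents X, v ∈ C :=
  ⟨_, ⟨v, hv, rfl⟩, ⟨hv, .refl⟩, ⟨hv, .refl⟩⟩

theorem notMem_of_mem_strongComponent {G : Digraph V} {X C : Set V}
    (hC : C ∈ G.strongComponents X) {v : V} (hv : v ∈ C) : v ∉ X := by
  obtain ⟨u, hu, rfl⟩ := hC
  exact hv.2.1

theorem nonempty_of_mem_strongComponents {G : Digraph V} {X C : Set V}
    (hC : C ∈ G.strongComponents X) : C.Nonempty := by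
  obtain ⟨u, hu, rfl⟩ := hC
  exact ⟨u, ⟨hu, .refl⟩, ⟨hu, .refl⟩⟩

theorem reachAvoiding_of_mem {G : Digraph V} {X C : Set V} (hC : C ∈ G.strongComponents X)
    {v w : V} (hv : v ∈ C) (hw : w ∈ C) : G.ReachAvoiding X v w := by
  obtain ⟨u, hu, rfl⟩ := hC
  exact hv.2.trans hw.1

theorem mem_of_reachAvoiding {G : Digraph V} {X C : Set V} (hC : C ∈ G.strongComponents X)
    {v w : V} (hv : v ∈ C) (h₁ : G.ReachAvoiding X v w) (h₂ : G.ReachAvoiding X w v) :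
    w ∈ C := by
  obtain ⟨u, hu, rfl⟩ := hC
  exact ⟨hv.1.trans h₁, h₂.trans hv.2⟩

theorem strongComponent_subset {G G' : Digraph V} (hG : ∀ a b, G.Adj a b → G'.Adj a b)
    {X Y : Set V} (h : X ⊆ Y) {C : Set V} (hC : C ∈ G.strongComponents Y) :
    ∃ C' ∈ G'.strongComponents X, C ⊆ C' := by
  obtain ⟨v, hv⟩ := nonempty_of_mem_strongComponents hC
  have key : ∀ a b, G.ReachAvoiding Y a b → G'.ReachAvoiding X a b := fun a b hab =>
    ReachAvoiding.mono h ⟨hab.1, Relation.ReflTransGen.mono (fun _ _ h' => ⟨hG _ _ h'.1, h'.2⟩) _ _ hab.2⟩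
  obtain ⟨C', hC', hv'⟩ := G'.exists_strongComponent
    (fun hX => notMem_of_mem_strongComponent hC hv (h hX))
  exact ⟨C', hC', fun w hw => mem_of_reachAvoiding hC' hv'
    (key _ _ (reachAvoiding_of_mem hC hv hw)) (key _ _ (reachAvoiding_of_mem hC hw hv))⟩

/-- A walk between two vertices of a strong component stays in that component. -/
theorem walk_in_strongComponent {G : Digraph V} {X C : Set V} (hC : C ∈ G.strongComponents X)
    {u w : V} (hu : u ∈ C) (hw : w ∈ C) :
    Relation.ReflTransGen (fun a b => G.Adj a b ∧ a ∈ C ∧ b ∈ C) u w := by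
  have h := (reachAvoiding_of_mem hC hu hw).2
  induction h using Relation.ReflTransGen.head_induction_on with
  | refl => exact .refl
  | @head a b hab hbw ih =>
    have hb : b ∈ C := mem_of_reachAvoiding hC hu
      ⟨notMem_of_mem_strongComponent hC hu, .single hab⟩
      (ReachAvoiding.trans ⟨hab.2, hbw⟩ (reachAvoiding_of_mem hC hw hu))
    exact .head ⟨hab.1, hu, hb⟩ (ih hb)

/-! ### Ends -/

theorem exists_represents {G : Digraph V} (ω : G.Ends) : ∃ R, G.Represents R ω := by
  obtain ⟨⟨R, hR⟩, rfl⟩ := Quotient.exists_rep ω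
  exact ⟨R, hR, rfl⟩

theorem HasTailIn.mono {R : ℕ → V} {C C' : Set V} (h : C ⊆ C') (hR : HasTailIn R C) :
    HasTailIn R C' := by
  obtain ⟨n, hn⟩ := hR
  exact ⟨n, fun m hm => h (hn m hm)⟩

theorem HasTailIn.exists_mem {R : ℕ → V} {C C' : Set V} (h : HasTailIn R C)
    (h' : HasTailIn R C') : ∃ n, R n ∈ C ∧ R n ∈ C' := by
  obtain ⟨n, hn⟩ := h
  obtain ⟨n', hn'⟩ := h'
  exact ⟨max n n', hn _ (le_max_left _ _), hn' _ (le_max_right _ _)⟩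

theorem endComponent_eq {G : Digraph V} {X : Finset V} {ω : G.Ends} {R : ℕ → V} {C : Set V}
    (h : G.Represents R ω) (hC : C ∈ G.strongComponents (X : Set V)) (hR : HasTailIn R C) :
    G.endComponent X ω = C :=
  tail_component_eq (endComponent_spec X h).1 hC (endComponent_spec X h).2 hR

theorem endComponent_mem {G : Digraph V} (X : Finset V) (ω : G.Ends) :
    G.endComponent X ω ∈ G.strongComponents (X : Set V) :=
  (endComponent_spec X (exists_represents ω).choose_spec).1

theorem Represents.end_eq {G : Digraph V} {R : ℕ → V} {ω η : G.Ends} (h : G.Represents R ω)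
    (h' : G.Represents R η) : ω = η := by
  obtain ⟨_, rfl⟩ := h
  obtain ⟨_, rfl⟩ := h'
  rfl

theorem end_eq_of_endComponent_eq {G : Digraph V} {ω η : G.Ends}
    (h : ∀ X, G.endComponent X ω = G.endComponent X η) : ω = η := by
  obtain ⟨R, hR⟩ := exists_represents ω
  obtain ⟨S, hS⟩ := exists_represents η
  have hR' := hR
  have hS' := hS
  obtain ⟨_, rfl⟩ := hR'
  obtain ⟨_, rfl⟩ := hS'
  refine Quotient.sound fun X => ⟨_, endComponent_mem X _, (endComponent_spec X hR).2, ?_⟩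
  rw [h X]
  exact (endComponent_spec X hS).2

theorem endComponent_subset {G : Digraph V} {X Y : Finset V} (h : X ⊆ Y) (ω : G.Ends) :
    G.endComponent Y ω ⊆ G.endComponent X ω := by
  obtain ⟨R, hR⟩ := exists_represents ω
  obtain ⟨C, hC, hYC⟩ := strongComponent_subset (G := G) (G' := G) (fun _ _ => id)
    (Finset.coe_subset.2 h) (endComponent_mem Y ω)
  rwa [endComponent_eq hR hC ((endComponent_spec Y hR).2.mono hYC)]

theorem endComponent_eq_mono {G : Digraph V} {X Y : Finset V} (h : X ⊆ Y) {ω η : G.Ends}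
    (hY : G.endComponent Y ω = G.endComponent Y η) :
    G.endComponent X ω = G.endComponent X η := by
  obtain ⟨v, hv⟩ := nonempty_of_mem_strongComponents (endComponent_mem Y ω)
  exact strongComponents_eq (endComponent_mem X ω) (endComponent_mem X η)
    (endComponent_subset h ω hv) (endComponent_subset h η (hY ▸ hv))

/-! ### Maps between horizons -/

section Horizon

variable {W : Type*} {G : Digraph V} {G' : Digraph W}

/-- The map of horizons induced by a map of ends that preserves limit edges. -/
def Horizon.map (f : G.Ends → G'.Ends)
    (hf : ∀ ω η, G.IsLimitEdge ω η → G'.IsLimitEdge (f ω) (f η)) : G.Horizon → G'.Horizon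
  | .ofEnd ω => .ofEnd (f ω)
  | .inner l t => .inner ⟨f l.tail, f l.head, hf _ _ l.isLimitEdge⟩ t

theorem isOpen_endNhd (G : Digraph V) {ε : ℝ} (hε : 0 < ε) (X : Finset V) (ω : G.Ends) :
    IsOpen (G.endNhd ε X ω) :=
  TopologicalSpace.isOpen_generateFrom_of_mem (.inl ⟨ε, X, ω, hε, rfl⟩)

/-- Basic neighbourhoods of inner points require a set separating the endpoints. Some finite set
separates two distinct ends, and adding it to `X` only shrinks the neighbourhood. -/
theorem exists_edgeNhd (G : Digraph V) {δ : ℝ} (hδ : 0 < δ) (z : Set.Ioo (0 : ℝ) 1)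
    (X : Finset V) (l : G.LimitEdge) :
    ∃ U : Set G.Horizon, IsOpen U ∧ .inner l z ∈ U ∧ ∀ p ∈ U, ∃ l' t, p = .inner l' t ∧
      G.endComponent X l'.tail = G.endComponent X l.tail ∧
      G.endComponent X l'.head = G.endComponent X l.head ∧ |(t : ℝ) - z| < δ := by
  classical
  obtain ⟨Y, hY⟩ : ∃ Y, G.SeparatesEnds Y l.tail l.head := by
    by_contra! h
    exact l.isLimitEdge.1 (end_eq_of_endComponent_eq fun X => not_not.1 (h X))
  have hpos : 0 < min δ (min (z : ℝ) (1 - z)) :=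
    lt_min hδ (lt_min z.2.1 (sub_pos.2 z.2.2))
  refine ⟨G.edgeNhd (min δ (min (z : ℝ) (1 - z))) z (X ∪ Y) l,
    TopologicalSpace.isOpen_generateFrom_of_mem (.inr ⟨_, z, X ∪ Y, l, hpos,
      (min_le_right _ _).trans (min_le_left _ _), (min_le_right _ _).trans (min_le_right _ _),
      fun h => hY (endComponent_eq_mono Finset.subset_union_right h), rfl⟩),
    ⟨rfl, rfl, by simpa using hpos⟩, ?_⟩
  rintro (ω | ⟨l', t⟩) hp
  · exact hp.elim
  · exact ⟨l', t, rfl, endComponent_eq_mono Finset.subset_union_left hp.1,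
      endComponent_eq_mono Finset.subset_union_left hp.2.1, hp.2.2.trans_le (min_le_left _ _)⟩

/-- The map fixes the parameter on each limit edge, so only the components of the endpoints need
control, and `X` provides it for all ends at once. -/
theorem Horizon.continuous_map (f : G.Ends → G'.Ends)
    (hf : ∀ ω η, G.IsLimitEdge ω η → G'.IsLimitEdge (f ω) (f η))
    (h : ∀ Y : Finset W, ∃ X : Finset V, ∀ ω η, G.endComponent X ω = G.endComponent X η →
      G'.endComponent Y (f ω) = G'.endComponent Y (f η)) :
    Continuous (Horizon.map f hf) := by
  refine continuous_generateFrom_iff.2 ?_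
  rintro U (⟨ε, Y, ω, hε, rfl⟩ | ⟨ε, z, Y, l, hε, -, -, -, rfl⟩)
  · obtain ⟨X, hX⟩ := h Y
    refine isOpen_iff_forall_mem_open.2 ?_
    rintro (η | ⟨l, t⟩) hp
    · refine ⟨G.endNhd ε X η, ?_, isOpen_endNhd G hε X η, rfl⟩
      have hp : G'.endComponent Y (f η) = G'.endComponent Y ω := hp
      rintro (η' | ⟨l, t⟩) hq
      · exact (hX _ _ hq).trans hp
      · rcases hq with hq | hq | hq
        · exact .inl ⟨(hX _ _ hq.1).trans hp, (hX _ _ hq.2).trans hp⟩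
        · exact .inr (.inl ⟨(hX _ _ hq.1).trans hp, hq.2⟩)
        · exact .inr (.inr ⟨(hX _ _ hq.1).trans hp, hq.2⟩)
    · rcases hp with hp | hp | hp
      -- Both endpoints live in the component, so the radius is irrelevant here; in the next two
      -- cases it is the slack left in the strict inequality.
      · obtain ⟨U, hU, hlU, hUs⟩ := exists_edgeNhd G one_pos t X l
        refine ⟨U, fun p hpU => ?_, hU, hlU⟩
        obtain ⟨l', t', rfl, h₁, h₂, -⟩ := hUs p hpU
        exact .inl ⟨(hX _ _ h₁).trans hp.1, (hX _ _ h₂).trans hp.2⟩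
      · obtain ⟨U, hU, hlU, hUs⟩ := exists_edgeNhd G (sub_pos.2 hp.2) t X l
        refine ⟨U, fun p hpU => ?_, hU, hlU⟩
        obtain ⟨l', t', rfl, h₁, h₂, h₃⟩ := hUs p hpU
        exact .inr (.inl ⟨(hX _ _ h₁).trans hp.1, by linarith [(abs_lt.1 h₃).2]⟩)
      · obtain ⟨U, hU, hlU, hUs⟩ := exists_edgeNhd G (sub_pos.2 hp.2) t X l
        refine ⟨U, fun p hpU => ?_, hU, hlU⟩
        obtain ⟨l', t', rfl, h₁, h₂, h₃⟩ := hUs p hpU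
        exact .inr (.inr ⟨(hX _ _ h₂).trans hp.1, by linarith [(abs_lt.1 h₃).1]⟩)
  · obtain ⟨X, hX⟩ := h Y
    refine isOpen_iff_forall_mem_open.2 ?_
    rintro (η | ⟨l', t⟩) hp
    · exact hp.elim
    · obtain ⟨U, hU, hlU, hUs⟩ := exists_edgeNhd G (sub_pos.2 hp.2.2) t X l'
      refine ⟨U, fun p hpU => ?_, hU, hlU⟩
      obtain ⟨l'', t', rfl, h₁, h₂, h₃⟩ := hUs p hpU
      refine ⟨(hX _ _ h₁).trans hp.1, (hX _ _ h₂).trans hp.2.1, ?_⟩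
      linarith [abs_sub_le (t' : ℝ) t z]

/-- A bijection of ends that preserves limit edges and the uniform structure given by the end
components extends to a homeomorphism of horizons. -/
def Horizon.homeomorph (e : G.Ends ≃ G'.Ends)
    (hl : ∀ ω η, G.IsLimitEdge ω η ↔ G'.IsLimitEdge (e ω) (e η))
    (h : ∀ Y : Finset W, ∃ X : Finset V, ∀ ω η, G.endComponent X ω = G.endComponent X η →
      G'.endComponent Y (e ω) = G'.endComponent Y (e η))
    (h' : ∀ X : Finset V, ∃ Y : Finset W, ∀ ω η,
      G'.endComponent Y (e ω) = G'.endComponent Y (e η) →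
      G.endComponent X ω = G.endComponent X η) : G.Horizon ≃ₜ G'.Horizon where
  toFun := Horizon.map e fun ω η => (hl ω η).1
  invFun := Horizon.map e.symm fun ω η hωη => (hl _ _).2 (by simpa using hωη)
  left_inv := by rintro (ω | ⟨⟨a, b, hab⟩, t⟩) <;> simp [Horizon.map]
  right_inv := by rintro (ω | ⟨⟨a, b, hab⟩, t⟩) <;> simp [Horizon.map]
  continuous_toFun := Horizon.continuous_map _ _ h
  continuous_invFun := Horizon.continuous_map _ _ fun X => by
    obtain ⟨Y, hY⟩ := h' X
    exact ⟨Y, fun ω η hωη => hY _ _ (by simpa using hωη)⟩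

end Horizon

namespace Arborescence

variable {D : Digraph V} (T : D.Arborescence)

/-! ### The tree order -/

/-- The vertices that are reached from the root in exactly `n` steps. -/
def level : ℕ → Set V
  | 0 => {T.root}
  | n + 1 => {w | ∃ v ∈ level n, T.Adj v w}

/-- The distance of a vertex from the root. -/
noncomputable def height (v : V) : ℕ := sInf {n | v ∈ T.level n}

variable {T}

/-- Parents are unique and the root has none, so tracing back from `v` is deterministic. -/
theorem level_unique {m n : ℕ} {v : V} (hm : v ∈ T.level m) (hn : v ∈ T.level n) : m = n := by
  induction m generalizing n v with
  | zero =>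
    cases n with
    | zero => rfl
    | succ n =>
      obtain ⟨u, -, hu⟩ := hn
      obtain rfl : v = T.root := hm
      exact (T.not_adj_root _ hu).elim
  | succ m ih =>
    obtain ⟨u, hum, hu⟩ := hm
    cases n with
    | zero =>
      obtain rfl : v = T.root := hn
      exact (T.not_adj_root _ hu).elim
    | succ n =>
      obtain ⟨u', hun, hu'⟩ := hn
      obtain rfl := T.parent_unique hu hu'
      rw [ih hum hun]

theorem height_eq {n : ℕ} {v : V} (h : v ∈ T.level n) : T.height v = n :=
  level_unique (Nat.sInf_mem (s := {n | v ∈ T.level n}) ⟨n, h⟩) h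

theorem mem_level_height {v : V} (hv : v ∈ T.verts) : v ∈ T.level (T.height v) := by
  have : ∃ n, v ∈ T.level n := by
    induction T.reach_root v hv with
    | refl => exact ⟨0, rfl⟩
    | tail hab hbc ih =>
      obtain ⟨n, hn⟩ := ih (T.mem_of_adj hbc).1
      exact ⟨n + 1, _, hn, hbc⟩
  exact Nat.sInf_mem this

theorem height_root : T.height T.root = 0 := height_eq (rfl : T.root ∈ T.level 0)

theorem height_of_adj {v w : V} (h : T.Adj v w) : T.height w = T.height v + 1 :=
  height_eq ⟨v, mem_level_height (T.mem_of_adj h).1, h⟩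

theorem height_mono {v w : V} (h : T.le v w) : T.height v ≤ T.height w := by
  induction h with
  | refl => exact le_rfl
  | tail _ hbc ih => exact ih.trans (by rw [height_of_adj hbc]; omega)

theorem eq_of_le_of_height_le {v w : V} (h : T.le v w) (hh : T.height w ≤ T.height v) :
    v = w := by
  obtain rfl | ⟨u, hu, huw⟩ := Relation.ReflTransGen.cases_tail h
  · rfl
  · have := height_mono hu
    have := height_of_adj huw
    omega

/-- Unique parents make the set of vertices below `w` a chain. -/
theorem le_or_le {u v w : V} (hu : T.le u w) (hv : T.le v w) : T.le u v ∨ T.le v u := by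
  induction hu with
  | refl => exact .inr hv
  | tail hub hbc ih =>
    obtain rfl | ⟨b', hvb', hb'⟩ := Relation.ReflTransGen.cases_tail hv
    · exact .inl (hub.tail hbc)
    · obtain rfl := T.parent_unique hb' hbc
      exact ih hvb'

theorem le_of_le_of_height_le {u v w : V} (hu : T.le u w) (hv : T.le v w)
    (h : T.height u ≤ T.height v) : T.le u v := by
  rcases le_or_le hu hv with h' | h'
  · exact h'
  · obtain rfl := eq_of_le_of_height_le h' h
    exact h'

theorem eq_of_le_of_height_eq {u v w : V} (hu : T.le u w) (hv : T.le v w)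
    (h : T.height u = T.height v) : u = v :=
  eq_of_le_of_height_le (le_of_le_of_height_le hu hv h.le) h.ge

theorem not_le_of_height_eq {u v : V} (hne : u ≠ v) (h : T.height u = T.height v) :
    ¬ T.le u v := fun huv => hne (eq_of_le_of_height_le huv h.ge)

theorem adj_of_le {u v : V} (h : T.le u v) (hh : T.height v = T.height u + 1) : T.Adj u v := by
  obtain rfl | ⟨w, huw, hwv⟩ := Relation.ReflTransGen.cases_tail h
  · omega
  · have := height_of_adj hwv
    rwa [eq_of_le_of_height_le huw (by omega)]

theorem exists_le_height_eq (hspan : T.IsSpanning) (v : V) {m : ℕ} (hm : m ≤ T.height v) :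
    ∃ u, T.le u v ∧ T.height u = m := by
  induction T.reach_root v (hspan ▸ Set.mem_univ v) with
  | refl => exact ⟨_, .refl, by rw [height_root] at *; omega⟩
  | @tail b c _ hbc ih =>
    rcases Nat.lt_or_ge (T.height b) m with h | h
    · exact ⟨c, .refl, by have := height_of_adj hbc; omega⟩
    · obtain ⟨u, hu, hum⟩ := ih h
      exact ⟨u, hu.tail hbc, hum⟩

/-! ### Rays of the arborescence that start at the root -/

variable (T) in
/-- `R` is a ray of `T` that starts at the root. -/
def IsRootRay (R : ℕ → V) : Prop := T.toDigraph.IsRay R ∧ R 0 = T.root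

theorem height_rootRay {R : ℕ → V} (h0 : R 0 = T.root) (hR : ∀ n, T.Adj (R n) (R (n + 1)))
    (n : ℕ) : T.height (R n) = n := by
  induction n with
  | zero => rw [h0, height_root]
  | succ n ih => rw [height_of_adj (hR n), ih]

theorem IsRootRay.height {R : ℕ → V} (hR : T.IsRootRay R) (n : ℕ) : T.height (R n) = n :=
  height_rootRay hR.2 hR.1.2 n

theorem isRootRay_of_adj {R : ℕ → V} (h0 : R 0 = T.root) (hR : ∀ n, T.Adj (R n) (R (n + 1))) :
    T.IsRootRay R :=
  ⟨⟨fun m n h => by rw [← height_rootRay h0 hR m, ← height_rootRay h0 hR n, h], hR⟩, h0⟩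

theorem IsRootRay.le {R : ℕ → V} (hR : T.IsRootRay R) {m n : ℕ} (h : m ≤ n) :
    T.le (R m) (R n) := by
  induction n, h using Nat.le_induction with
  | base => exact .refl
  | succ n _ ih => exact ih.tail (hR.1.2 n)

theorem IsRootRay.hasTailIn {R : ℕ → V} (hR : T.IsRootRay R) {n : ℕ} {C : Set V}
    (h : ∀ w, T.le (R n) w → w ∈ C) : HasTailIn R C :=
  ⟨n, fun _ hm => h _ (hR.le hm)⟩

theorem IsRootRay.eq_of_hasTailIn {R : ℕ → V} (hR : T.IsRootRay R) {v : V} {C : Set V}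
    (hC : ∀ w ∈ C, T.le v w) (h : HasTailIn R C) : R (T.height v) = v := by
  obtain ⟨k, hk⟩ := h
  exact eq_of_le_of_height_eq (hR.le (le_max_right k (T.height v)))
    (hC _ (hk _ (le_max_left _ _))) (hR.height _)

/-! ### Digraphs whose ends are displayed by the arborescence -/

variable (T) in
/-- The strong components of `G - X`, for finite `X`, and the up-closures of the vertices of
a given height refine each other. -/
structure Displays (G : Digraph V) : Prop where
  upClosure_subset : ∀ X : Finset V, ∃ n, ∀ v, T.height v = n →
    ∃ C ∈ G.strongComponents (X : Set V), ∀ w, T.le v w → w ∈ C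
  component_subset : ∀ n, ∃ X : Finset V, ∀ C ∈ G.strongComponents (X : Set V),
    ∃ v, T.height v = n ∧ ∀ w ∈ C, T.le v w

/-- Only one half of `Displays` is assumed, so that this also serves the solidification of `T`. -/
theorem isSolidRay_of_isRootRay {G : Digraph V} (hsub : ∀ v w, T.Adj v w → G.Adj v w)
    (hG : ∀ X : Finset V, ∃ n, ∀ v, T.height v = n →
      ∃ C ∈ G.strongComponents (X : Set V), ∀ w, T.le v w → w ∈ C)
    {R : ℕ → V} (hR : T.IsRootRay R) : G.IsSolidRay R := by
  refine ⟨⟨hR.1.1, fun n => hsub _ _ (hR.1.2 n)⟩, fun X => ?_⟩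
  obtain ⟨n, hn⟩ := hG X
  obtain ⟨C, hC, hRC⟩ := hn (R n) (hR.height n)
  exact ⟨C, hC, hR.hasTailIn hRC⟩

namespace Displays

variable {G : Digraph V}

/-- At each height one vertex has a tail of `S` above it. Vertices chosen at consecutive heights lie
below a common vertex of `S`, hence are adjacent in `T`. -/
theorem exists_rootRay (hG : T.Displays G) (hsub : ∀ v w, T.Adj v w → G.Adj v w)
    (ω : G.Ends) : ∃ R, T.IsRootRay R ∧ G.Represents R ω := by
  obtain ⟨S, hS⟩ := exists_represents ω
  have h : ∀ n, ∃ v, T.height v = n ∧ HasTailIn S {w | T.le v w} := fun n => by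
    obtain ⟨X, hX⟩ := hG.component_subset n
    obtain ⟨v, hv, hvC⟩ := hX _ (endComponent_mem X ω)
    exact ⟨v, hv, (endComponent_spec X hS).2.mono hvC⟩
  choose R hRn hRS using h
  have hadj : ∀ n, T.Adj (R n) (R (n + 1)) := fun n => by
    obtain ⟨k, h₁, h₂⟩ := (hRS n).exists_mem (hRS (n + 1))
    exact adj_of_le (le_of_le_of_height_le h₁ h₂ (by rw [hRn, hRn]; omega)) (by rw [hRn, hRn])
  -- Vertices outside `T` also get height `0`, as `sInf ∅ = 0`; the tree edge leaving `R 0` rules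
  -- them out.
  have h0 : R 0 = T.root := by
    have hlev := mem_level_height (T.mem_of_adj (hadj 0)).1
    rw [hRn 0] at hlev
    exact hlev
  have hR : T.IsRootRay R := isRootRay_of_adj h0 hadj
  have hsol := isSolidRay_of_isRootRay hsub hG.upClosure_subset hR
  refine ⟨R, hR, hsol, ?_⟩
  refine end_eq_of_endComponent_eq fun X => ?_
  obtain ⟨n, hn⟩ := hG.upClosure_subset X
  obtain ⟨C, hC, hRC⟩ := hn (R n) (hRn n)
  rw [endComponent_eq ⟨hsol, rfl⟩ hC (hR.hasTailIn hRC),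
    endComponent_eq hS hC ((hRS n).mono hRC)]

/-- This and `eq_of_endComponent_eq` translate between components and `n`-th vertices of root rays;
`n` and `X` are uniform in the ends. -/
theorem endComponent_eq_of_eq (hG : T.Displays G) (X : Finset V) :
    ∃ n, ∀ R S ω η, T.IsRootRay R → T.IsRootRay S → G.Represents R ω → G.Represents S η →
      (∀ w, T.le (R n) w → w ∈ G.endComponent X ω) ∧
      (R n = S n → G.endComponent X ω = G.endComponent X η) := by
  obtain ⟨n, hn⟩ := hG.upClosure_subset X
  refine ⟨n, fun R S ω η hR hS hRω hSη => ?_⟩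
  obtain ⟨C, hC, hRC⟩ := hn (R n) (hR.height n)
  have h₁ := endComponent_eq hRω hC (hR.hasTailIn hRC)
  refine ⟨fun w hw => h₁ ▸ hRC w hw, fun h => ?_⟩
  rw [h₁, endComponent_eq hSη hC (hS.hasTailIn (h ▸ hRC))]

theorem eq_of_endComponent_eq (hG : T.Displays G) (n : ℕ) :
    ∃ X, ∀ R S ω η, T.IsRootRay R → T.IsRootRay S → G.Represents R ω → G.Represents S η →
      (∀ w ∈ G.endComponent X ω, T.le (R n) w) ∧
      (G.endComponent X ω = G.endComponent X η → R n = S n) := by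
  obtain ⟨X, hX⟩ := hG.component_subset n
  refine ⟨X, fun R S ω η hR hS hRω hSη => ?_⟩
  obtain ⟨v, rfl, hv⟩ := hX _ (endComponent_mem X ω)
  have h₁ := hR.eq_of_hasTailIn hv (endComponent_spec X hRω).2
  refine ⟨by rwa [h₁], fun h => ?_⟩
  rw [h₁, hS.eq_of_hasTailIn hv (h ▸ (endComponent_spec X hSη).2)]

theorem rootRay_unique (hG : T.Displays G) {R S : ℕ → V} {ω : G.Ends} (hR : T.IsRootRay R)
    (hS : T.IsRootRay S) (hRω : G.Represents R ω) (hSω : G.Represents S ω) : R = S := by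
  funext n
  obtain ⟨X, hX⟩ := hG.eq_of_endComponent_eq n
  exact (hX R S ω ω hR hS hRω hSω).2 rfl

/-- The end components and the up-closures along the two rays are cofinal in each other, so edges
between the smaller sets give edges between the larger ones. -/
theorem isLimitEdge_iff (hG : T.Displays G) {R S : ℕ → V} {ω η : G.Ends}
    (hR : T.IsRootRay R) (hS : T.IsRootRay S) (hRω : G.Represents R ω)
    (hSη : G.Represents S η) :
    G.IsLimitEdge ω η ↔
      R ≠ S ∧ ∀ n, R n ≠ S n → ∃ a b, T.le (R n) a ∧ T.le (S n) b ∧ G.Adj a b := by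
  refine and_congr ?_ ⟨fun h n hn => ?_, fun h X hX => ?_⟩
  · refine not_congr ⟨?_, ?_⟩
    · rintro rfl
      exact hG.rootRay_unique hR hS hRω hSη
    · rintro rfl
      exact hRω.end_eq hSη
  · obtain ⟨X, hX⟩ := hG.eq_of_endComponent_eq n
    have h₁ := hX R S ω η hR hS hRω hSη
    have h₂ := hX S R η ω hS hR hSη hRω
    obtain ⟨a, ha, b, hb, hab⟩ := h X fun he => hn (h₁.2 he)
    exact ⟨a, b, h₁.1 a ha, h₂.1 b hb, hab⟩
  · obtain ⟨n, hn⟩ := hG.endComponent_eq_of_eq X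
    have h₁ := hn R S ω η hR hS hRω hSη
    have h₂ := hn S R η ω hS hR hSη hRω
    obtain ⟨a, b, ha, hb, hab⟩ := h n fun he => hX (h₁.2 he)
    exact ⟨a, h₁.1 a ha, b, h₂.1 b hb, hab⟩

/-- If two digraphs are both displayed by `T`, then the end components of one refine those of
the other. -/
theorem endComponent_refine {G' : Digraph V} (hG : T.Displays G) (hG' : T.Displays G')
    (hsub : ∀ v w, T.Adj v w → G.Adj v w) (f : G.Ends → G'.Ends)
    (hf : ∀ R ω, T.IsRootRay R → G.Represents R ω → G'.Represents R (f ω)) (Y : Finset V) :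
    ∃ X : Finset V, ∀ ω η, G.endComponent X ω = G.endComponent X η →
      G'.endComponent Y (f ω) = G'.endComponent Y (f η) := by
  obtain ⟨n, hn⟩ := hG'.endComponent_eq_of_eq Y
  obtain ⟨X, hX⟩ := hG.eq_of_endComponent_eq n
  refine ⟨X, fun ω η h => ?_⟩
  obtain ⟨R, hR, hRω⟩ := hG.exists_rootRay hsub ω
  obtain ⟨S, hS, hSη⟩ := hG.exists_rootRay hsub η
  exact (hn R S _ _ hR hS (hf R ω hR hRω) (hf S η hS hSη)).2
    ((hX R S ω η hR hS hRω hSη).2 h)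

end Displays

/-! ### Strong components and normality -/

variable (T) in
/-- `G` contains `T`, and each edge of `G` between the up-closures of two incomparable vertices
is witnessed by an edge of the normal assistant. -/
structure Governs (G : Digraph V) : Prop where
  adj_sub : ∀ v w, T.Adj v w → G.Adj v w
  cross : ∀ v w a b, ¬ T.le v w → ¬ T.le w v → T.le v a → T.le w b → G.Adj a b →
    T.normalAssistant.Adj v w

theorem mem_verts (hspan : T.IsSpanning) (v : V) : v ∈ T.verts := hspan ▸ Set.mem_univ v

/-- A spanning `T` leaves no vertex for the interior of a `T`-path. -/
theorem adj_of_hasTPath (hspan : T.IsSpanning) {a b : V} (h : T.HasTPath a b) : D.Adj a b := by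
  obtain ⟨-, -, l, hl, hc, -⟩ := h
  cases l with
  | nil => simpa using hc
  | cons x l => exact (hl x (by simp) (mem_verts hspan x)).elim

theorem governs_self (hspan : T.IsSpanning) : T.Governs D where
  adj_sub _ _ := T.adj_sub
  cross v w a b hvw hwv hva hwb hab := by
    refine .inr ⟨mem_verts hspan v, mem_verts hspan w, hvw, hwv, a, b, hva, hwb,
      mem_verts hspan a, mem_verts hspan b, [], by simp, by simpa using hab, ?_⟩
    have : a ≠ b := by
      rintro rfl
      exact (le_or_le hva hwb).elim hvw hwv
    simpa using this

theorem le_of_adj {v w : V} (h : T.Adj v w) : T.le v w := .single h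

theorem not_le_of_le_of_le {v w a b : V} (hvw : ¬ T.le v w) (hwv : ¬ T.le w v) (hva : T.le v a)
    (hwb : T.le w b) : ¬ T.le a b := fun h =>
  (le_or_le (hva.trans h) hwb).elim hvw hwv

/-- Tree edges and their reverses join comparable vertices and cannot cross; an added edge carries a
`T`-path, here an edge of `D`. -/
theorem exists_adj_of_assistant_adj (hspan : T.IsSpanning) {v w a b : V} (hvw : ¬ T.le v w)
    (hwv : ¬ T.le w v) (hva : T.le v a) (hwb : T.le w b)
    (hab : T.assistantSolidification.Adj a b) :
    ∃ a' b', T.le v a' ∧ T.le w b' ∧ D.Adj a' b' := by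
  rcases hab with (hab | ⟨-, -, -, -, a', b', ha, hb, hab⟩) | hab
  · exact (not_le_of_le_of_le hvw hwv hva hwb (le_of_adj hab)).elim
  · exact ⟨a', b', hva.trans ha, hwb.trans hb, adj_of_hasTPath hspan hab⟩
  · exact (not_le_of_le_of_le hwv hvw hwb hva (le_of_adj hab)).elim

theorem governs_assistantSolidification (hspan : T.IsSpanning) :
    T.Governs T.assistantSolidification where
  adj_sub _ _ h := .inl (.inl h)
  cross v w a b hvw hwv hva hwb hab := by
    obtain ⟨a', b', ha, hb, h⟩ := exists_adj_of_assistant_adj hspan hvw hwv hva hwb hab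
    exact (governs_self hspan).cross v w a' b' hvw hwv ha hb h

/-- Project the walk to the children of `m`: each step stays above one child or crosses to another,
and a crossing gives an assistant edge. -/
theorem Governs.child_reach {G : Digraph V} (hG : T.Governs G) {C : Set V} {m u w c d : V}
    (hm : ∀ x ∈ C, ∃ c, T.Adj m c ∧ T.le c x)
    (h : Relation.ReflTransGen (fun a b => G.Adj a b ∧ a ∈ C ∧ b ∈ C) u w)
    (hc : T.Adj m c) (hcu : T.le c u) (hd : T.Adj m d) (hdw : T.le d w) :
    Relation.ReflTransGen T.normalAssistant.Adj c d := by
  induction h using Relation.ReflTransGen.head_induction_on generalizing c with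
  | refl =>
    rw [eq_of_le_of_height_eq hcu hdw (by rw [height_of_adj hc, height_of_adj hd])]
  | head hab _ ih =>
    obtain ⟨e, he, heb⟩ := hm _ hab.2.2
    have hh : T.height c = T.height e := by rw [height_of_adj hc, height_of_adj he]
    by_cases hce : c = e
    · exact ih (hce ▸ hc) (hce ▸ heb)
    · exact .head (hG.cross c e _ _ (not_le_of_height_eq hce hh)
        (not_le_of_height_eq (Ne.symm hce) hh.symm) hcu heb hab.1) (ih he heb)

/-- A strong component has a least element in the tree order. -/
theorem Governs.exists_least {G : Digraph V} (hG : T.Governs G) (hspan : T.IsSpanning)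
    (hnormal : T.IsNormal) {X C : Set V} (hC : C ∈ G.strongComponents X) :
    ∃ t ∈ C, ∀ w ∈ C, T.le t w := by
  obtain ⟨w₀, hw₀⟩ := nonempty_of_mem_strongComponents hC
  -- Climb from a lower bound `m` outside `C` to a child that is still a lower bound; `k` bounds the
  -- remaining height below `w₀`.
  have key : ∀ k m, (∀ w ∈ C, T.le m w) → T.height w₀ ≤ T.height m + k →
      ∃ t ∈ C, ∀ w ∈ C, T.le t w := by
    intro k
    induction k with
    | zero =>
      intro m hm hk
      obtain rfl := eq_of_le_of_height_le (hm _ hw₀) hk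
      exact ⟨m, hw₀, hm⟩
    | succ k ih =>
      intro m hm hk
      by_cases hmC : m ∈ C
      · exact ⟨m, hmC, hm⟩
      have hchild : ∀ x ∈ C, ∃ c, T.Adj m c ∧ T.le c x := fun x hx => by
        obtain rfl | h := Relation.ReflTransGen.cases_head (hm x hx)
        · exact (hmC hx).elim
        · exact h
      obtain ⟨c, hc, hcw⟩ := hchild w₀ hw₀
      refine ih c (fun w hw => ?_) (by rw [height_of_adj hc]; omega)
      obtain ⟨d, hd, hdw⟩ := hchild w hw
      have h₁ := hG.child_reach hchild (walk_in_strongComponent hC hw₀ hw) hc hcw hd hdw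
      have h₂ := hG.child_reach hchild (walk_in_strongComponent hC hw hw₀) hd hdw hc hcw
      -- If `c` and `d` differ, the walks both ways close a directed cycle in the assistant.
      rcases Relation.reflTransGen_iff_eq_or_transGen.1 h₁ with rfl | h₁
      · exact hdw
      · exact (hnormal _ (h₁.trans_left h₂)).elim
  exact key (T.height w₀) T.root (fun w _ => T.reach_root w (mem_verts hspan w)) (by omega)

theorem reachAvoiding_of_le {G : Digraph V} (hsub : ∀ v w, T.Adj v w → G.Adj v w) {X : Set V}
    {v w : V} (hX : ∀ x ∈ X, T.height x < T.height v) (h : T.le v w) :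
    G.ReachAvoiding X v w := by
  refine ⟨fun hv => (hX v hv).false, ?_⟩
  induction h with
  | refl => exact .refl
  | tail hab hbc ih =>
    exact ih.tail ⟨hsub _ _ hbc, fun hc =>
      ((hX _ hc).trans_le (height_mono (hab.tail hbc))).false⟩

/-! ### Finite levels and displayed ends -/

/-- After deleting the finitely many vertices of height below `n`, each vertex of height `n` is the
least element of its component, so distinct ones lie in distinct components. -/
theorem finite_height_lt (hD : D.IsSolidDigraph) (hspan : T.IsSpanning) (hnormal : T.IsNormal)
    (n : ℕ) : {v | T.height v < n}.Finite := by
  induction n with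
  | zero => simp
  | succ n ih =>
    have hfin := hD ih.toFinset
    rw [ih.coe_toFinset] at hfin
    suffices h : {v | T.height v = n}.Finite from
      (ih.union h).subset fun v (hv : _ < _) => (Nat.lt_succ_iff_lt_or_eq.1 hv)
    have hc : ∀ v, T.height v = n → ∃ C ∈ D.strongComponents {v | T.height v < n}, v ∈ C :=
      fun v hv => D.exists_strongComponent (by simp [hv])
    choose! C hC hvC using hc
    refine Set.Finite.of_finite_image (f := C) (hfin.subset ?_) ?_
    · rintro _ ⟨v, hv, rfl⟩
      exact hC v hv
    · intro v hv w hw hvw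
      obtain ⟨t, htC, ht⟩ := (governs_self hspan).exists_least hspan hnormal (hC v hv)
      have hth : n ≤ T.height t := by simpa using notMem_of_mem_strongComponent (hC v hv) htC
      have hv' : T.height v = n := hv
      have hw' : T.height w = n := hw
      have h₁ := eq_of_le_of_height_le (ht v (hvC v hv)) (by omega)
      have h₂ := eq_of_le_of_height_le (ht w (hvw ▸ hvC w hw)) (by omega)
      rw [← h₁, ← h₂]

theorem exists_height_bound (X : Finset V) : ∃ n, ∀ x ∈ X, T.height x < n :=
  ⟨X.sup T.height + 1, fun _ hx => Nat.lt_succ_of_le (Finset.le_sup hx)⟩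

theorem Governs.component_subset {G : Digraph V} (hG : T.Governs G) (hspan : T.IsSpanning)
    (hnormal : T.IsNormal) {n : ℕ} (hfin : {v | T.height v < n}.Finite) :
    ∃ X : Finset V, ∀ C ∈ G.strongComponents (X : Set V),
      ∃ v, T.height v = n ∧ ∀ w ∈ C, T.le v w := by
  refine ⟨hfin.toFinset, fun C hC => ?_⟩
  rw [hfin.coe_toFinset] at hC
  obtain ⟨t, htC, ht⟩ := hG.exists_least hspan hnormal hC
  obtain ⟨v, hvt, hv⟩ := exists_le_height_eq hspan t (m := n)
    (by simpa using notMem_of_mem_strongComponent hC htC)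
  exact ⟨v, hv, fun w hw => hvt.trans (ht w hw)⟩

theorem displays_self (hD : D.IsSolidDigraph) (hspan : T.IsSpanning) (hnormal : T.IsNormal) :
    T.Displays D where
  component_subset n := (governs_self hspan).component_subset hspan hnormal
    (finite_height_lt hD hspan hnormal n)
  upClosure_subset X := by
    obtain ⟨N, hN⟩ := T.exists_height_bound X
    have hfin := finite_height_lt hD hspan hnormal N
    have hcomp := hD hfin.toFinset
    rw [hfin.coe_toFinset] at hcomp
    have hleast : ∀ C ∈ D.strongComponents {v | T.height v < N}, ∃ t ∈ C, ∀ w ∈ C, T.le t w :=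
      fun C hC => (governs_self hspan).exists_least hspan hnormal hC
    have : Nonempty V := ⟨T.root⟩
    choose! t htC ht using hleast
    obtain ⟨M, hM⟩ := (hcomp.image fun C => T.height (t C)).bddAbove
    -- `N` keeps `v` outside the deleted set; `M` puts `v` at least as high as every least element.
    refine ⟨max M N, fun v hv => ?_⟩
    obtain ⟨C, hC, hvC⟩ := D.exists_strongComponent (X := {v | T.height v < N}) (v := v)
      (by simp [hv])
    obtain ⟨C', hC', hCC'⟩ := strongComponent_subset (G := D) (G' := D) (fun _ _ => id)
      (X := (X : Set V)) (fun x hx => hN x hx) hC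
    refine ⟨C', hC', fun w hvw => hCC' ?_⟩
    have hlt : ∀ x ∈ {v | T.height v < N}, T.height x < T.height v :=
      fun x (hx : T.height x < N) => by omega
    obtain ⟨K, hK, hwK⟩ := D.exists_strongComponent (X := {v | T.height v < N}) (v := w)
      (by have := height_mono hvw; simp; omega)
    have hMK : T.height (t K) ≤ M := hM ⟨K, hK, rfl⟩
    have hNK : N ≤ T.height (t K) := by
      simpa using notMem_of_mem_strongComponent hK (htC K hK)
    -- Now `t K ≤ v ≤ w` in the tree order, and `K` leads back from `w` to `t K`; hence `v` lies in
    -- `K` too.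
    have htv : T.le (t K) v := le_of_le_of_height_le (ht K hK w hwK) hvw (by omega)
    have hvK : v ∈ K := mem_of_reachAvoiding hK (htC K hK)
      (reachAvoiding_of_le (fun _ _ => T.adj_sub)
        (fun x hx => lt_of_lt_of_le hx hNK) htv)
      ((reachAvoiding_of_le (fun _ _ => T.adj_sub) hlt hvw).trans
        (reachAvoiding_of_mem hK hwK (htC K hK)))
    rwa [strongComponents_eq hC hK hvC hvK]

theorem reachAvoiding_solidify_of_ge {G : Digraph V} {X : Set V} {v w : V}
    (hX : ∀ x ∈ X, T.height x < T.height v) (h : T.le v w) :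
    (T.solidify G).ReachAvoiding X w v := by
  induction h with
  | refl => exact ⟨fun hv => (hX v hv).false, .refl⟩
  | tail hab hbc ih =>
    refine ReachAvoiding.trans ⟨fun hc => ?_, .single ⟨.inr hbc, ih.1⟩⟩ ih
    exact ((hX _ hc).trans_le (height_mono (hab.tail hbc))).false

/-- Above the height of `X`, tree edges and their reverses make each up-closure strongly connected.
-/
theorem upClosure_subset_solidify {G : Digraph V} (hsub : ∀ v w, T.Adj v w → G.Adj v w)
    (X : Finset V) : ∃ n, ∀ v, T.height v = n →
      ∃ C ∈ (T.solidify G).strongComponents (X : Set V), ∀ w, T.le v w → w ∈ C := by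
  obtain ⟨n, hn⟩ := T.exists_height_bound X
  refine ⟨n, fun v hv => ?_⟩
  subst hv
  obtain ⟨C, hC, hvC⟩ := (T.solidify G).exists_strongComponent (X := (X : Set V)) (v := v)
    fun h => (hn v h).false
  exact ⟨C, hC, fun w hw => mem_of_reachAvoiding hC hvC
    (reachAvoiding_of_le (G := T.solidify G) (fun a b h => .inl (hsub a b h)) hn hw)
    (reachAvoiding_solidify_of_ge hn hw)⟩

theorem displays_assistantSolidification (hD : D.IsSolidDigraph) (hspan : T.IsSpanning)
    (hnormal : T.IsNormal) : T.Displays T.assistantSolidification where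
  component_subset n := (governs_assistantSolidification hspan).component_subset hspan hnormal
    (finite_height_lt hD hspan hnormal n)
  upClosure_subset := upClosure_subset_solidify (G := T.normalAssistant) fun _ _ h => .inl h

/-! ### Comparison of ends and limit edges -/

theorem isSolidRay_mono {G G' : Digraph V} (h : ∀ a b, G.Adj a b → G'.Adj a b) {R : ℕ → V}
    (hR : G.IsSolidRay R) : G'.IsSolidRay R := by
  refine ⟨⟨hR.1.1, fun n => h _ _ (hR.1.2 n)⟩, fun X => ?_⟩
  obtain ⟨C, hC, hRC⟩ := hR.2 X
  obtain ⟨C', hC', hCC'⟩ := strongComponent_subset h (subset_refl (X : Set V)) hC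
  exact ⟨C', hC', hRC.mono hCC'⟩

/-- The map of ends induced by the inclusion of a spanning subdigraph. -/
def endsMap {G G' : Digraph V} (h : ∀ a b, G.Adj a b → G'.Adj a b) : G.Ends → G'.Ends :=
  Quotient.map' (s₁ := G.endSetoid) (s₂ := G'.endSetoid)
    (fun R => ⟨R.1, isSolidRay_mono h R.2⟩) fun R S hRS X => by
      obtain ⟨C, hC, hRC, hSC⟩ := hRS X
      obtain ⟨C', hC', hCC'⟩ := strongComponent_subset h (subset_refl (X : Set V)) hC
      exact ⟨C', hC', hRC.mono hCC', hSC.mono hCC'⟩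

theorem represents_endsMap {G G' : Digraph V} (h : ∀ a b, G.Adj a b → G'.Adj a b) {R : ℕ → V}
    {ω : G.Ends} (hR : G.Represents R ω) : G'.Represents R (endsMap h ω) := by
  obtain ⟨hR, rfl⟩ := hR
  exact ⟨isSolidRay_mono h hR, rfl⟩

/-- The limit edges of `D` and those of the solidified normal assistant join corresponding pairs
of ends. -/
theorem isLimitEdge_assistant_iff (hD : D.IsSolidDigraph) (hspan : T.IsSpanning)
    (hnormal : T.IsNormal) {R S : ℕ → V} (hR : T.IsRootRay R) (hS : T.IsRootRay S)
    {ω η : D.Ends} {ω' η' : T.assistantSolidification.Ends} (hRω : D.Represents R ω)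
    (hSη : D.Represents S η) (hRω' : T.assistantSolidification.Represents R ω')
    (hSη' : T.assistantSolidification.Represents S η') :
    D.IsLimitEdge ω η ↔ T.assistantSolidification.IsLimitEdge ω' η' := by
  rw [(displays_self hD hspan hnormal).isLimitEdge_iff hR hS hRω hSη,
    (displays_assistantSolidification hD hspan hnormal).isLimitEdge_iff hR hS hRω' hSη']
  refine and_congr_right fun _ => forall_congr' fun n => forall_congr' fun hn => ?_
  -- Distinct vertices of equal height are incomparable, so only crossing edges matter.
  have h₁ := not_le_of_height_eq hn (by rw [hR.height, hS.height])
  have h₂ := not_le_of_height_eq hn.symm (by rw [hR.height, hS.height])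
  constructor
  · rintro ⟨a, b, ha, hb, hab⟩
    exact ⟨a, b, ha, hb, .inl ((governs_self hspan).cross a b a b
      (not_le_of_le_of_le h₁ h₂ ha hb) (not_le_of_le_of_le h₂ h₁ hb ha) .refl .refl hab)⟩
  · rintro ⟨a, b, ha, hb, hab⟩
    exact exists_adj_of_assistant_adj hspan h₁ h₂ ha hb hab

end Arborescence

end Digraph

open Digraph Arborescence in
theorem mainTheorem2 {V : Type*} (D : Digraph V) (hD : D.IsSolidDigraph)
    (T : D.Arborescence) (hspan : T.IsSpanning) (hnormal : T.IsNormal) :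
    T.ReflectsHorizon := by
  have hdD := displays_self hD hspan hnormal
  have hdH := displays_assistantSolidification hD hspan hnormal
  have hsubD : ∀ v w, T.Adj v w → D.Adj v w := fun _ _ => T.adj_sub
  have hsubH : ∀ v w, T.Adj v w → T.assistantSolidification.Adj v w := fun _ _ h => .inl (.inl h)
  have hTH : ∀ v w, T.solidification.Adj v w → T.assistantSolidification.Adj v w :=
    fun _ _ h => h.imp .inl id
  choose ray hray hrep using hdD.exists_rootRay hsubD
  have hsolT : ∀ R, T.IsRootRay R → T.solidification.IsSolidRay R := fun R hR =>
    isSolidRay_of_isRootRay (G := T.solidification) (fun _ _ h => .inl h) (upClosure_subset_solidify (G := T.toDigraph) fun _ _ h => h) hR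
  let ψ : D.Ends → T.solidification.Ends := fun ω =>
    Quotient.mk T.solidification.endSetoid ⟨ray ω, hsolT _ (hray ω)⟩
  let ζ : T.solidification.Ends → T.assistantSolidification.Ends := endsMap hTH
  have hψ : ∀ R ω, T.IsRootRay R → D.Represents R ω → T.solidification.Represents R (ψ ω) := by
    intro R ω hR hRω
    obtain rfl := hdD.rootRay_unique hR (hray ω) hRω (hrep ω)
    exact ⟨hsolT _ hR, rfl⟩
  have hζψ : ∀ R ω, T.IsRootRay R → D.Represents R ω →
      T.assistantSolidification.Represents R (ζ (ψ ω)) := fun R ω hR hRω =>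
    represents_endsMap hTH (hψ R ω hR hRω)
  have hbij : Function.Bijective (ζ ∘ ψ) := by
    constructor
    · intro ω η h
      have hη := hζψ _ _ (hray η) (hrep η)
      rw [← show ζ (ψ ω) = ζ (ψ η) from h] at hη
      have h' := hdH.rootRay_unique (hray ω) (hray η) (hζψ _ _ (hray ω) (hrep ω)) hη
      exact (hrep ω).end_eq (h' ▸ hrep η)
    · intro η
      -- Every root ray is also solid in `D`, so the root ray of `η` defines the required preimage.
      obtain ⟨R, hR, hRη⟩ := hdH.exists_rootRay hsubH η
      have hRD := isSolidRay_of_isRootRay hsubD hdD.upClosure_subset hR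
      exact ⟨Quotient.mk D.endSetoid ⟨R, hRD⟩, (hζψ R _ hR ⟨hRD, rfl⟩).end_eq hRη⟩
  let e : D.Ends ≃ T.assistantSolidification.Ends := Equiv.ofBijective _ hbij
  have hl : ∀ ω η, D.IsLimitEdge ω η ↔ T.assistantSolidification.IsLimitEdge (e ω) (e η) :=
    fun ω η => isLimitEdge_assistant_iff hD hspan hnormal (hray ω) (hray η) (hrep ω) (hrep η)
      (hζψ _ _ (hray ω) (hrep ω)) (hζψ _ _ (hray η) (hrep η))
  -- The inverse also preserves root rays, which gives the refinement of components in the other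
  -- direction.
  have hsymm : ∀ R η, T.IsRootRay R → T.assistantSolidification.Represents R η →
      D.Represents R (e.symm η) := by
    intro R η hR hRη
    have h := hζψ _ _ (hray (e.symm η)) (hrep (e.symm η))
    rw [show ζ (ψ (e.symm η)) = η from e.apply_symm_apply η] at h
    rw [hdH.rootRay_unique hR (hray _) hRη h]
    exact hrep _
  refine ⟨ψ, ζ, fun ω => ⟨⟨ray ω, ⟨(hray ω).1, (hray ω).2, hrep ω⟩, ?_⟩, ?_⟩, ?_, hbij, ?_⟩
  · rintro R ⟨hR, hR0, hRω⟩
    exact hdD.rootRay_unique ⟨hR, hR0⟩ (hray ω) hRω (hrep ω)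
  · exact fun R hR hR0 hRω => hψ R ω ⟨hR, hR0⟩ hRω
  · exact fun ε R hR => represents_endsMap hTH hR
  · refine ⟨Horizon.homeomorph e hl (hdD.endComponent_refine hdH hsubD e hζψ) fun X => ?_,
      fun ω => rfl⟩
    obtain ⟨Y, hY⟩ := hdH.endComponent_refine hdD hsubH e.symm hsymm X
    exact ⟨Y, fun ω η h => by simpa using hY _ _ h⟩
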